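/- **Neural networks.** A ReLU neural network (NN) is a finite directed acyclic graph of neurons with a real weight $w_{uv}$ on each arc $uv$ and a real bias $b_v$ at each neuron $v$ that has an incoming arc. Its *depth* $k\ge 1$ is the length of a longest path. The neurons are partitioned into layers $V_0\cup V_1\cup\dots\cup V_k$ such that the layer index strictly increases along each arc (arcs may skip layers), $V_0$ is exactly the set of neurons without incoming arcs (input neurons) and $V_k$ is exactly the set of neurons without outgoing arcs (output neurons); the other neurons are hidden. The *width* is $\max\{|V_1|,\dots,|V_{k-1}|\}$ ($0$ if $k=1$) and the *size* is $\sum_{\ell=1}^{k-1}|V_\ell|$. On an input vector, whose entries are the outputs $o(v)$ of the input neurons, each other neuron has the activation $a(v)=b_v+\sum_{u:\,uv\text{ is an arc}} w_{uv}\,o(u)$, each hidden neuron has the output $o(v)=\max\{0,a(v)\}$, and the output vector of the NN consists of the activations of the output neurons. **Maximum flows.** Let $G=(V,E)$ be a directed graph without loops and parallel arcs, with $V=\{v_1,\dots,v_n\}$ and $|E|=m\ge 1$, and let $s,t\in V$. Given capacities $\nu_e\ge 0$ $(e\in E)$, an $s$-$t$-flow is a vector $(y_e)_{e\in E}$ with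 $0\le y_e\le \nu_e$ for all $e \in E$ and with inflow equal to outflow at every node other than $s$ and $t$. It is maximum if its value, that is, the outflow minus the inflow at $s$, is largest possible. Let $\vec E$ be the set of pairs $v_iv_j$ with $i<j$ such that $v_iv_j\in E$ or $v_jv_i\in E$. (If $E$ contains the reverse of each of its arcs, then $\vec E=\{v_iv_j\in E: i<j\}$.) A flow $y$ is represented by the vector $(x_e)_{e\in\vec E}$ with $x_{uv}=y_{uv}-y_{vu}$, where $y_e:=0$ for $e\notin E$; thus a negative value $x_{uv}$ stands for flow on the arc $vu$. **Statement.** There is an absolute constant $C$ such that for all $n$, $m\ge 1$, $G$, $s$ and $t$ as above there is an NN of depth at most $C m^2n^2$, size at most $C m^2n^2$ and width at most $C$ that maps every vector of capacities $(\nu_e)_{e\in E}\in\mathbb{R}_{\ge 0}^{E}$ to a vector $(x_e)_{e\in\vec E}$ representing a maximum $s$-$t$-flow in $G$ for these capacities. In short: there is an NN of depth and size $\mathcal O(m^2n^2)$ and width $\mathcal O(1)$ that maps arc capacities to a maximum $s$-$t$-flow. -/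

import Mathlib

/-- A feedforward neural network with rectified linear units, with input coordinates indexed by
`ι` and output coordinates indexed by `κ`: a finite directed graph on a set `V` of neurons with
real arc weights and biases, whose neurons are partitioned into the layers `0, …, depth`. Arcs may
skip layers. Weights of pairs that are not arcs and biases of input neurons are irrelevant. -/
structure ReLUNN (ι κ : Type) where
  /-- the neurons -/
  V : Type
  [fintypeV : Fintype V]
  [decidableEqV : DecidableEq V]
  /-- the arcs -/
  arcs : Finset (V × V)
  weight : V × V → ℝ
  bias : V → ℝ
  depth : ℕ
  depth_pos : 0 < depth
  /-- the index of the layer of a neuron -/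
  layer : V → ℕ
  layer_le : ∀ v, layer v ≤ depth
  layer_lt : ∀ u v, (u, v) ∈ arcs → layer u < layer v
  /-- There is a path of length `depth`; by `layer_le` and `layer_lt` no path is longer. -/
  longest_path : ∃ p : Fin (depth + 1) → V, ∀ i : Fin depth, (p i.castSucc, p i.succ) ∈ arcs
  /-- Layer `0` consists exactly of the neurons without incoming arcs. -/
  layer_eq_zero_iff : ∀ v, layer v = 0 ↔ ∀ u, (u, v) ∉ arcs
  /-- The last layer consists exactly of the neurons without outgoing arcs. -/
  layer_eq_depth_iff : ∀ v, layer v = depth ↔ ∀ w, (v, w) ∉ arcs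
  /-- the input neurons, labelled by the input coordinates -/
  input : ι ≃ {v : V // layer v = 0}
  /-- the output neurons, labelled by the output coordinates -/
  output : κ ≃ {v : V // layer v = depth}

attribute [instance] ReLUNN.fintypeV ReLUNN.decidableEqV

namespace ReLUNN

variable {ι κ : Type}

/-- The number of neurons in layer `l`. -/
def layerCard (N : ReLUNN ι κ) (l : ℕ) : ℕ :=
  (Finset.univ.filter fun v : N.V => N.layer v = l).card

/-- The maximal number of neurons in a hidden layer (`0` if there is no hidden layer). -/
def width (N : ReLUNN ι κ) : ℕ := (Finset.Ioo 0 N.depth).sup N.layerCard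

/-- The number of hidden neurons. -/
def size (N : ReLUNN ι κ) : ℕ := ∑ l ∈ Finset.Ioo 0 N.depth, N.layerCard l

/-- The output `o(v)` of a neuron on input `x`: the corresponding entry of `x` for an input neuron,
and the positive part of the activation for a hidden neuron. (The value at an output neuron is
not used.) -/
noncomputable def out (N : ReLUNN ι κ) (x : ι → ℝ) (v : N.V) : ℝ :=
  if h : N.layer v = 0 then x (N.input.symm ⟨v, h⟩)
  else max 0 (N.bias v +
    ∑ u : {u : N.V // (u, v) ∈ N.arcs}, N.weight (u.1, v) * N.out x u.1)
termination_by N.layer v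
decreasing_by exact N.layer_lt _ _ u.2

/-- The activation `a(v)` of a neuron that is not an input neuron. -/
noncomputable def activation (N : ReLUNN ι κ) (x : ι → ℝ) (v : N.V) : ℝ :=
  N.bias v + ∑ u : {u : N.V // (u, v) ∈ N.arcs}, N.weight (u.1, v) * N.out x u.1

/-- The function computed by the network: the activations of the output neurons. -/
noncomputable def forwardPass (N : ReLUNN ι κ) (x : ι → ℝ) : κ → ℝ :=
  fun j => N.activation x (N.output j).1

end ReLUNN

namespace MaxFlow

variable {n : ℕ}

/-- `y` is an `s`-`t`-flow in the directed graph on `Fin n` with arc set `E` and capacities `ν`: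
`0 ≤ y_e ≤ ν_e` on all arcs, and inflow equals outflow at every node other than `s` and `t`. -/
def IsFlow (E : Finset (Fin n × Fin n)) (s t : Fin n) (ν y : E → ℝ) : Prop :=
  (∀ e, 0 ≤ y e ∧ y e ≤ ν e) ∧
  ∀ v, v ≠ s → v ≠ t → ∑ e : E with e.1.2 = v, y e = ∑ e : E with e.1.1 = v, y e

/-- The value of a flow: outflow minus inflow at the source `s`. -/
def value (E : Finset (Fin n × Fin n)) (s : Fin n) (y : E → ℝ) : ℝ :=
  ∑ e : E with e.1.1 = s, y e - ∑ e : E with e.1.2 = s, y e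

/-- `y` is an `s`-`t`-flow of maximum value. -/
def IsMaxFlow (E : Finset (Fin n × Fin n)) (s t : Fin n) (ν y : E → ℝ) : Prop :=
  IsFlow E s t ν y ∧ ∀ y' : E → ℝ, IsFlow E s t ν y' → value E s y' ≤ value E s y

/-- The forward arcs `(u, v)` with `u < v` such that `(u, v)` or `(v, u)` is an arc. If `E`
contains the reverse of each of its arcs, these are the arcs `(u, v) ∈ E` with `u < v`. -/
def forwardArcs (E : Finset (Fin n × Fin n)) : Finset (Fin n × Fin n) :=
  Finset.univ.filter fun e => e.1 < e.2 ∧ (e ∈ E ∨ e.swap ∈ E)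

/-- The flow on an ordered pair of nodes, which is `0` if the pair is not an arc. -/
def flowOn (E : Finset (Fin n × Fin n)) (y : E → ℝ) (e : Fin n × Fin n) : ℝ :=
  if h : e ∈ E then y ⟨e, h⟩ else 0

/-- The representation of a flow by one signed value for each forward arc: the flow on the arc
minus the flow on the reverse arc. -/
def signed (E : Finset (Fin n × Fin n)) (y : E → ℝ) : forwardArcs E → ℝ :=
  fun e => flowOn E y e.1 - flowOn E y e.1.swap

end MaxFlow

/-! A network cannot branch, so the proof needs a maximum flow algorithm that is a fixed sequence of
linear maps and positive parts; minima are allowed because min(f, g) = f - max(0, f - g). Once `K`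
positive parts suffice, `ReLUNN.exists_of_reluSteps` turns them into `K` hidden layers of one neuron
each, with skip arcs making all earlier values available.

The algorithm augments along shortest paths, in the spirit of Edmonds-Karp and Dinic. Let A consist
of the arcs and their reverses. For k = 0, ..., n - 1 the residual capacities are augmented |A|
times along walks of length k from s to t. One augmentation (`push`) distributes flow greedily over
k levels and then withdraws, level by level, what could not continue. If the throughput of s is
positive, some arc is saturated (`push_saturates`); otherwise nothing changes.

The analysis uses labels d, lower bounds for the distances from s, which the network never computes.
Flow uses only arcs along which d rises by one (`push_support`), so the arcs that gain residual
capacity lower d, and the set of admissible arcs shrinks strictly as long as a walk of length k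
exists. After |A| rounds there is none, and the labels can be raised until d t is at least k + 1
(`IsLabeling.exists_succ_le`). Once d t is at least n, a label value is skipped, which yields a
saturated cut and hence maximality. An augmentation costs 6|A|k positive parts, and summing over all
rounds gives O(m²n²). -/

/-! ### Function spaces generated by positive parts. -/

/-- `ReluSteps K W W'` says that the space `W'` of functions arises from `W` by `K` times
adjoining the positive part of a function. -/
inductive ReluSteps {X : Type} : ℕ → Submodule ℝ (X → ℝ) → Submodule ℝ (X → ℝ) → Prop
  | refl (W : Submodule ℝ (X → ℝ)) : ReluSteps 0 W W
  | adjoin {K : ℕ} {W W' : Submodule ℝ (X → ℝ)} (h : ReluSteps K W W') (f : X → ℝ) (hf : f ∈ W') :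
      ReluSteps (K + 1) W (W' ⊔ Submodule.span ℝ {fun x => max 0 (f x)})

namespace ReluSteps

variable {X : Type} {K L : ℕ} {W W' W'' : Submodule ℝ (X → ℝ)}

lemma le (h : ReluSteps K W W') : W ≤ W' := by
  induction h with
  | refl => exact le_rfl
  | adjoin _ _ _ ih => exact ih.trans le_sup_left

lemma trans (h : ReluSteps K W W') (h' : ReluSteps L W' W'') : ReluSteps (K + L) W W'' := by
  induction h' with
  | refl => exact h
  | adjoin _ f hf ih => exact (ih h).adjoin f hf

lemma exists_min (hW : ReluSteps K W W') {f g : X → ℝ} (hf : f ∈ W') (hg : g ∈ W') :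
    ∃ W'', ReluSteps (K + 1) W W'' ∧ W' ≤ W'' ∧ (fun x => min (f x) (g x)) ∈ W'' := by
  refine ⟨_, hW.adjoin (f - g) (sub_mem hf hg), le_sup_left, ?_⟩
  have h : (fun x => min (f x) (g x)) = f - fun x => max 0 ((f - g) x) := by
    ext x
    simp only [Pi.sub_apply]
    rcases le_total (f x) (g x) with h | h
    · rw [min_eq_left h, max_eq_left (by linarith), sub_zero]
    · rw [min_eq_right h, max_eq_right (by linarith), sub_sub_cancel]
  rw [h]
  exact sub_mem (Submodule.mem_sup_left hf)
    (Submodule.mem_sup_right (Submodule.mem_span_singleton_self _))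

lemma exists_mins {α : Type} (A : Finset α) (W : Submodule ℝ (X → ℝ)) {f g : α → X → ℝ}
    (hf : ∀ e ∈ A, f e ∈ W) (hg : ∀ e ∈ A, g e ∈ W) :
    ∃ W', ReluSteps A.card W W' ∧ ∀ e ∈ A, (fun x => min (f e x) (g e x)) ∈ W' := by
  classical
  induction A using Finset.induction_on with
  | empty => exact ⟨W, .refl W, by simp⟩
  | insert e A he ih =>
    obtain ⟨W', h, hmin⟩ := ih (fun a ha => hf a (Finset.mem_insert_of_mem ha))
      fun a ha => hg a (Finset.mem_insert_of_mem ha)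
    obtain ⟨W'', h'', hle, hmin''⟩ := h.exists_min (h.le (hf e (Finset.mem_insert_self e A)))
      (h.le (hg e (Finset.mem_insert_self e A)))
    refine ⟨W'', by rwa [Finset.card_insert_of_notMem he], fun a ha => ?_⟩
    rcases Finset.mem_insert.1 ha with rfl | ha
    exacts [hmin'', hle (hmin a ha)]

/-- Listing the adjoined functions in order exposes the triangular dependence that the chain of
hidden neurons needs. -/
lemma exists_sequence (h : ReluSteps K W W') : ∃ g : ℕ → X → ℝ,
    (∀ j < K, ∃ f ∈ W ⊔ Submodule.span ℝ (g '' Set.Iio j), g j = fun x => max 0 (f x)) ∧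
    W' = W ⊔ Submodule.span ℝ (g '' Set.Iio K) := by
  induction h with
  | refl => exact ⟨0, by simp, by simp⟩
  | @adjoin K W W' _ f hf ih =>
    obtain ⟨g, hg, rfl⟩ := ih
    have key : ∀ j ≤ K, Function.update g K (fun x => max 0 (f x)) '' Set.Iio j =
        g '' Set.Iio j := fun j hj => Set.image_congr fun l hl => by
      rw [Function.update_of_ne ((Set.mem_Iio.1 hl).trans_le hj).ne]
    refine ⟨Function.update g K fun x => max 0 (f x), fun j hj => ?_, ?_⟩
    · rw [key j (by omega)]
      rcases (Nat.lt_succ_iff.1 hj).eq_or_lt with rfl | hj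
      · exact ⟨f, hf, by simp⟩
      · obtain ⟨f', hf', h⟩ := hg j hj
        exact ⟨f', hf', by rw [Function.update_of_ne hj.ne, h]⟩
    · have : Set.Iio (K + 1) = insert K (Set.Iio K) := by
        ext j
        simp only [Set.mem_Iio, Set.mem_insert_iff]
        omega
      rw [this, Set.image_insert_eq, Set.insert_eq, Submodule.span_union, key K le_rfl,
        Function.update_self, sup_assoc, sup_comm (Submodule.span ℝ (g '' _))]

end ReluSteps

/-! ### From function spaces to networks with one neuron per hidden layer. -/

/-- The affine functions of the input. -/
def affineFunctions (ι : Type) : Submodule ℝ ((ι → ℝ) → ℝ) :=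
  Submodule.span ℝ (insert (fun _ => 1) (Set.range fun (i : ι) (x : ι → ℝ) => x i))

lemma one_mem_affineFunctions (ι : Type) : (fun _ => 1) ∈ affineFunctions ι :=
  Submodule.subset_span (Set.mem_insert _ _)

lemma coord_mem_affineFunctions {ι : Type} (i : ι) : (fun x => x i) ∈ affineFunctions ι :=
  Submodule.subset_span (Set.mem_insert_of_mem _ ⟨i, rfl⟩)

/-- The weights are padded by zeros to the common length `K`, so that all neurons share one index
type while neuron `j` still depends on earlier neurons only. -/
lemma exists_coefficients {ι : Type} [Fintype ι] {g : ℕ → (ι → ℝ) → ℝ} {j K : ℕ} (hj : j ≤ K)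
    {f : (ι → ℝ) → ℝ} (hf : f ∈ affineFunctions ι ⊔ Submodule.span ℝ (g '' Set.Iio j)) :
    ∃ (b : ℝ) (a : ι → ℝ) (w : Fin K → ℝ), (∀ l, j ≤ l.1 → w l = 0) ∧
      ∀ x, f x = b + (∑ i, a i * x i + ∑ l, w l * g l x) := by
  classical
  rw [affineFunctions, ← Submodule.span_union] at hf
  induction hf using Submodule.span_induction with
  | mem f hf =>
    rcases hf with (rfl | ⟨i, rfl⟩) | ⟨l, hl, rfl⟩
    · exact ⟨1, 0, 0, by simp, by simp⟩
    · exact ⟨0, Pi.single i 1, 0, by simp, fun x => by simp [Pi.single_apply]⟩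
    · rw [Set.mem_Iio] at hl
      refine ⟨0, 0, Pi.single ⟨l, by omega⟩ 1, fun l' hl' => ?_,
        fun x => by simp [Pi.single_apply]⟩
      rw [Pi.single_eq_of_ne]
      rintro rfl
      exact absurd hl' (by simpa using hl)
  | zero => exact ⟨0, 0, 0, by simp, by simp⟩
  | add f f' _ _ h h' =>
    obtain ⟨b, a, w, hw, hf⟩ := h
    obtain ⟨b', a', w', hw', hf'⟩ := h'
    refine ⟨b + b', a + a', w + w', fun l hl => by simp [hw l hl, hw' l hl], fun x => ?_⟩
    simp only [Pi.add_apply, hf, hf', add_mul, Finset.sum_add_distrib]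
    ring
  | smul r f _ h =>
    obtain ⟨b, a, w, hw, hf⟩ := h
    refine ⟨r * b, r • a, r • w, fun l hl => by simp [hw l hl], fun x => ?_⟩
    simp only [Pi.smul_apply, smul_eq_mul, hf, mul_add, Finset.mul_sum, mul_assoc]

namespace ReLUNN

section Chain

variable {ι κ : Type} [Fintype ι] [Fintype κ] [DecidableEq ι] [DecidableEq κ]

/-- The layer of a neuron in a network with `K` hidden layers of one neuron each. -/
def chainLayer (K : ℕ) : ι ⊕ Fin K ⊕ κ → ℕ
  | .inl _ => 0
  | .inr (.inl j) => j + 1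
  | .inr (.inr _) => K + 1

/-- The network with `K` hidden layers of one neuron each, in which each neuron receives arcs from
all neurons in earlier layers. -/
abbrev chain [Nonempty ι] [Nonempty κ] (K : ℕ)
    (weight : (ι ⊕ Fin K ⊕ κ) × (ι ⊕ Fin K ⊕ κ) → ℝ) (bias : ι ⊕ Fin K ⊕ κ → ℝ) :
    ReLUNN ι κ where
  V := ι ⊕ Fin K ⊕ κ
  arcs := Finset.univ.filter fun p => chainLayer K p.1 < chainLayer K p.2
  weight := weight
  bias := bias
  depth := K + 1
  depth_pos := K.succ_pos
  layer := chainLayer K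
  layer_le := by
    rintro (i | j | o) <;> simp only [chainLayer] <;> omega
  layer_lt u v h := (Finset.mem_filter.1 h).2
  longest_path := by
    -- Position `l` of the path is hidden neuron `l - 1`; the two ends are an arbitrary input and an
    -- arbitrary output, which is why `ι` and `κ` must be nonempty.
    refine ⟨fun l => if h0 : l.1 = 0 then .inl (Classical.arbitrary ι) else
      if h : l.1 - 1 < K then .inr (.inl ⟨l.1 - 1, h⟩) else .inr (.inr (Classical.arbitrary κ)),
      fun l => Finset.mem_filter.2 ⟨Finset.mem_univ _, ?_⟩⟩
    have hl := l.2
    simp only [Fin.val_castSucc, Fin.val_succ]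
    split_ifs <;> first | contradiction | (simp only [chainLayer]; omega)
  layer_eq_zero_iff v := by
    simp only [Finset.mem_filter, Finset.mem_univ, true_and, not_lt]
    refine ⟨fun h u => by omega, fun h => ?_⟩
    have := h (.inl (Classical.arbitrary ι))
    simpa [chainLayer] using this
  layer_eq_depth_iff v := by
    simp only [Finset.mem_filter, Finset.mem_univ, true_and, not_lt]
    refine ⟨?_, fun h => ?_⟩
    · rintro h (i | j | o) <;> rw [h] <;> simp only [chainLayer] <;> omega
    · have := h (.inr (.inr (Classical.arbitrary κ)))
      rcases v with i | j | o <;> simp only [chainLayer] at this ⊢ <;> omega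
  input :=
    { toFun := fun i => ⟨.inl i, rfl⟩
      invFun := fun v => match v with
        | ⟨.inl i, _⟩ => i
        | ⟨.inr (.inl _), h⟩ => absurd h (Nat.succ_ne_zero _)
        | ⟨.inr (.inr _), h⟩ => absurd h (Nat.succ_ne_zero _)
      left_inv := fun _ => rfl
      right_inv := by
        rintro ⟨i | j | o, h⟩
        exacts [rfl, absurd h (Nat.succ_ne_zero _), absurd h (Nat.succ_ne_zero _)] }
  output :=
    { toFun := fun o => ⟨.inr (.inr o), rfl⟩
      invFun := fun v => match v with
        | ⟨.inl _, h⟩ => absurd h (Nat.succ_ne_zero _).symm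
        | ⟨.inr (.inl j), h⟩ => absurd h (Nat.succ_lt_succ j.2).ne
        | ⟨.inr (.inr o), _⟩ => o
      left_inv := fun _ => rfl
      right_inv := by
        rintro ⟨i | j | o, h⟩
        exacts [absurd h (Nat.succ_ne_zero _).symm, absurd h (Nat.succ_lt_succ j.2).ne, rfl] }

variable [Nonempty ι] [Nonempty κ] {K : ℕ}
  {weight : (ι ⊕ Fin K ⊕ κ) × (ι ⊕ Fin K ⊕ κ) → ℝ} {bias : ι ⊕ Fin K ⊕ κ → ℝ}

lemma layerCard_chain {l : ℕ} (h : l ∈ Finset.Ioo 0 (chain K weight bias).depth) :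
    (chain K weight bias).layerCard l = 1 := by
  obtain ⟨h0, h1⟩ := Finset.mem_Ioo.1 h
  change l < K + 1 at h1
  refine Finset.card_eq_one.2 ⟨(.inr (.inl ⟨l - 1, by omega⟩) : ι ⊕ Fin K ⊕ κ), ?_⟩
  ext v
  rw [Finset.mem_filter, Finset.mem_singleton]
  refine ⟨fun ⟨_, hv⟩ => ?_, ?_⟩
  · change chainLayer K v = l at hv
    rcases v with i | j | o <;> simp only [chainLayer] at hv
    · omega
    · subst hv
      rfl
    · omega
  · rintro rfl
    exact ⟨Finset.mem_univ _, by change l - 1 + 1 = l; omega⟩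

lemma width_chain : (chain K weight bias).width ≤ 1 :=
  Finset.sup_le fun _ h => (layerCard_chain h).le

lemma size_chain : (chain K weight bias).size = K := by
  rw [size, Finset.sum_congr rfl fun _ h => layerCard_chain h]
  simp

lemma activation_chain (x : ι → ℝ) (v : ι ⊕ Fin K ⊕ κ) :
    (chain K weight bias).activation x v = bias v + ∑ u : ι ⊕ Fin K ⊕ κ,
      if chainLayer K u < chainLayer K v then weight (u, v) * (chain K weight bias).out x u
      else 0 := by
  rw [activation, ← Finset.sum_filter]
  congr 1
  exact (Finset.sum_subtype _ (fun u => by simp)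
    (fun u => weight (u, v) * (chain K weight bias).out x u)).symm

lemma out_chain_input (x : ι → ℝ) (i : ι) : (chain K weight bias).out x (.inl i) = x i := by
  rw [out, dif_pos (show (chain K weight bias).layer (.inl i) = 0 from rfl)]
  rfl

lemma out_chain_hidden (x : ι → ℝ) (j : Fin K) :
    (chain K weight bias).out x (.inr (.inl j)) =
      max 0 ((chain K weight bias).activation x (.inr (.inl j))) := by
  rw [out, dif_neg (show (chain K weight bias).layer (.inr (.inl j)) ≠ 0 from
    Nat.succ_ne_zero _)]
  rfl

lemma activation_chain_hidden (x : ι → ℝ) (j : Fin K) :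
    (chain K weight bias).activation x (.inr (.inl j)) = bias (.inr (.inl j)) +
      (∑ i, weight (.inl i, .inr (.inl j)) * x i + ∑ l : Fin K, if l < j then
        weight (.inr (.inl l), .inr (.inl j)) * (chain K weight bias).out x (.inr (.inl l))
        else 0) := by
  have hj := j.2.le
  simp [activation_chain, chainLayer, out_chain_input, hj.not_gt]

lemma activation_chain_output (x : ι → ℝ) (o : κ) :
    (chain K weight bias).activation x (.inr (.inr o)) = bias (.inr (.inr o)) +
      (∑ i, weight (.inl i, .inr (.inr o)) * x i + ∑ l : Fin K,
        weight (.inr (.inl l), .inr (.inr o)) * (chain K weight bias).out x (.inr (.inl l))) := by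
  simp [activation_chain, chainLayer, out_chain_input]

end Chain

lemma exists_of_reluSteps {ι κ : Type} [Fintype ι] [Fintype κ] [DecidableEq ι] [DecidableEq κ]
    [Nonempty ι] [Nonempty κ] {K : ℕ} {W : Submodule ℝ ((ι → ℝ) → ℝ)}
    (h : ReluSteps K (affineFunctions ι) W) {F : κ → (ι → ℝ) → ℝ} (hF : ∀ o, F o ∈ W) :
    ∃ N : ReLUNN ι κ, N.depth = K + 1 ∧ N.size = K ∧ N.width ≤ 1 ∧
      ∀ x o, N.forwardPass x o = F o x := by
  obtain ⟨g, hg, rfl⟩ := h.exists_sequence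
  have hidden : ∀ j : Fin K, ∃ (b : ℝ) (a : ι → ℝ) (w : Fin K → ℝ),
      (∀ l, j.1 ≤ l.1 → w l = 0) ∧
      ∀ x, g j x = max 0 (b + (∑ i, a i * x i + ∑ l, w l * g l x)) := by
    intro j
    obtain ⟨f, hf, hgj⟩ := hg j j.2
    obtain ⟨b, a, w, hw, hf⟩ := exists_coefficients j.2.le hf
    exact ⟨b, a, w, hw, fun x => by rw [hgj, ← hf]⟩
  choose b a w hw hgb using hidden
  choose b' a' w' _ hF' using fun o => exists_coefficients le_rfl (hF o)
  let weight : (ι ⊕ Fin K ⊕ κ) × (ι ⊕ Fin K ⊕ κ) → ℝ := fun p => match p with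
    | (.inl i, .inr (.inl j)) => a j i
    | (.inr (.inl l), .inr (.inl j)) => w j l
    | (.inl i, .inr (.inr o)) => a' o i
    | (.inr (.inl l), .inr (.inr o)) => w' o l
    | _ => 0
  let bias : ι ⊕ Fin K ⊕ κ → ℝ := fun v => match v with
    | .inr (.inl j) => b j
    | .inr (.inr o) => b' o
    | .inl _ => 0
  have hout : ∀ x (j : ℕ) (hj : j < K),
      (chain K weight bias).out x (.inr (.inl ⟨j, hj⟩)) = g j x := by
    intro x j
    induction j using Nat.strong_induction_on with
    | _ j ih =>
      intro hj
      rw [out_chain_hidden, activation_chain_hidden, hgb ⟨j, hj⟩]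
      congr 3
      refine Finset.sum_congr rfl fun l _ => ?_
      split_ifs with hl
      · rw [ih l hl]
      -- Where the chain has no arc, the padded weight is zero.
      · rw [hw ⟨j, hj⟩ l (not_lt.1 hl), zero_mul]
  refine ⟨chain K weight bias, rfl, size_chain, width_chain, fun x o => ?_⟩
  rw [hF']
  refine (activation_chain_output x o).trans ?_
  congr 2
  exact Finset.sum_congr rfl fun l _ => by rw [hout x l.1 l.2]

end ReLUNN

/-! ### Greedy distribution of an amount over slots. -/

namespace MaxFlow

variable {n : ℕ}

/-- The sum of the entries with index less than `j`. -/
def prefixSum (z : Fin n → ℝ) (j : ℕ) : ℝ := ∑ u : Fin n with u.1 < j, z u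

lemma prefixSum_zero (z : Fin n → ℝ) : prefixSum z 0 = 0 := by simp [prefixSum]

lemma prefixSum_card (z : Fin n → ℝ) : prefixSum z n = ∑ u, z u := by simp [prefixSum]

lemma prefixSum_succ (z : Fin n → ℝ) (w : Fin n) :
    prefixSum z (w.1 + 1) = prefixSum z w.1 + z w := by
  have h : (Finset.univ.filter fun u : Fin n => u.1 < w.1 + 1) =
      insert w (Finset.univ.filter fun u : Fin n => u.1 < w.1) := by
    ext u
    simp only [Finset.mem_filter, Finset.mem_univ, true_and, Finset.mem_insert, Fin.ext_iff]
    omega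
  rw [prefixSum, h, Finset.sum_insert (by simp), add_comm, prefixSum]

/-- Distributes the amount `Y` greedily, in the order of the indices, over slots of capacities
`z`. -/
noncomputable def greedy (Y : ℝ) (z : Fin n → ℝ) (w : Fin n) : ℝ :=
  min Y (prefixSum z (w.1 + 1)) - min Y (prefixSum z w.1)

lemma greedy_of_eq_zero (Y : ℝ) {z : Fin n → ℝ} {w : Fin n} (h : z w = 0) : greedy Y z w = 0 := by
  rw [greedy, prefixSum_succ, h, add_zero, sub_self]

/-- The differences of truncated prefix sums telescope. This form of `greedy` needs only two minima
per slot. -/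
lemma sum_greedy {Y : ℝ} (hY : 0 ≤ Y) (z : Fin n → ℝ) : ∑ w, greedy Y z w = min Y (∑ w, z w) := by
  unfold greedy
  rw [Fin.sum_univ_eq_sum_range (fun j => min Y (prefixSum z (j + 1)) - min Y (prefixSum z j)) n,
    Finset.sum_range_sub fun j => min Y (prefixSum z j), prefixSum_zero, prefixSum_card,
    min_eq_right hY, sub_zero]

lemma greedy_nonneg (Y : ℝ) {z : Fin n → ℝ} (hz : ∀ u, 0 ≤ z u) (w : Fin n) :
    0 ≤ greedy Y z w := by
  rw [greedy, prefixSum_succ, sub_nonneg]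
  exact min_le_min_left _ (le_add_of_nonneg_right (hz w))

lemma greedy_le_slot (Y : ℝ) {z : Fin n → ℝ} (hz : ∀ u, 0 ≤ z u) (w : Fin n) :
    greedy Y z w ≤ z w := by
  have := hz w
  rw [greedy, prefixSum_succ]
  rcases min_cases Y (prefixSum z w.1 + z w) with h | h <;>
    rcases min_cases Y (prefixSum z w.1) with h' | h' <;> linarith

lemma greedy_le_amount {Y : ℝ} (hY : 0 ≤ Y) {z : Fin n → ℝ} (hz : ∀ u, 0 ≤ z u) (w : Fin n) :
    greedy Y z w ≤ Y := by
  calc greedy Y z w ≤ ∑ u, greedy Y z u :=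
        Finset.single_le_sum (fun u _ => greedy_nonneg Y hz u) (Finset.mem_univ w)
    _ ≤ Y := by rw [sum_greedy hY]; exact min_le_left _ _

lemma prefixSum_le {z : Fin n → ℝ} (hz : ∀ u, 0 ≤ z u) (j : ℕ) : prefixSum z j ≤ ∑ u, z u :=
  Finset.sum_le_sum_of_subset_of_nonneg (Finset.filter_subset _ _) fun u _ _ => hz u

lemma greedy_eq_slot {Y : ℝ} {z : Fin n → ℝ} (hz : ∀ u, 0 ≤ z u) (h : ∑ u, z u ≤ Y) (w : Fin n) :
    greedy Y z w = z w := by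
  rw [greedy, min_eq_right ((prefixSum_le hz _).trans h), min_eq_right ((prefixSum_le hz _).trans h),
    prefixSum_succ, add_sub_cancel_left]

/-! ### Pushing flow along walks of a fixed length. -/

section Push

variable (A : Finset (Fin n × Fin n)) (s t : Fin n) (c : Fin n → Fin n → ℝ)

/-- The amount that the arc from `v` to `w` can carry if `w` can take up the amount `a w`. -/
noncomputable def slot (a : Fin n → ℝ) (v w : Fin n) : ℝ :=
  if (v, w) ∈ A then min (c v w) (a w) else 0

/-- An upper bound on the amount that can be sent from `v` to `t` along walks of length `i`. It is
positive if and only if there is such a walk. -/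
noncomputable def throughput : ℕ → Fin n → ℝ
  | 0, v => if v = t then 1 + ∑ u, c u t else 0
  | i + 1, v => ∑ w, slot A c (throughput i) v w

/-- The amounts sent along the arcs if the amounts `Y` available at the nodes are distributed
greedily. -/
noncomputable def forward (a Y : Fin n → ℝ) (v w : Fin n) : ℝ := greedy (Y v) (slot A c a v) w

/-- The amounts `f` on the arcs, reduced greedily such that the amounts `D` arrive. -/
noncomputable def backward (f : Fin n → Fin n → ℝ) (D : Fin n → ℝ) (v w : Fin n) : ℝ :=
  greedy (D w) (fun u => f u w) v

/-- Sends as much as possible of the amounts `Y` along walks of length `i` to `t`. Returns the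
amounts that leave the start nodes and the resulting flow. -/
noncomputable def push : ℕ → (Fin n → ℝ) → (Fin n → ℝ) × (Fin n → Fin n → ℝ)
  | 0, Y => (Y, 0)
  | i + 1, Y =>
    let f := forward A c (throughput A t c i) Y
    let r := push i fun w => ∑ v, f v w
    (fun v => ∑ w, backward f r.1 v w, fun v w => r.2 v w + backward f r.1 v w)

variable {A t c}

lemma slot_nonneg (hc : ∀ v w, 0 ≤ c v w) {a : Fin n → ℝ} (ha : ∀ v, 0 ≤ a v) (v w : Fin n) :
    0 ≤ slot A c a v w := by
  unfold slot
  split_ifs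
  exacts [le_min (hc v w) (ha w), le_rfl]

lemma slot_le_cap (hc : ∀ v w, 0 ≤ c v w) (a : Fin n → ℝ) (v w : Fin n) :
    slot A c a v w ≤ c v w := by
  unfold slot
  split_ifs
  exacts [min_le_left _ _, hc v w]

lemma slot_le {a : Fin n → ℝ} (ha : ∀ v, 0 ≤ a v) (v w : Fin n) : slot A c a v w ≤ a w := by
  unfold slot
  split_ifs
  exacts [min_le_right _ _, ha w]

lemma throughput_nonneg (hc : ∀ v w, 0 ≤ c v w) : ∀ i v, 0 ≤ throughput A t c i v
  | 0, v => by
    unfold throughput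
    split_ifs
    exacts [add_nonneg zero_le_one (Finset.sum_nonneg fun u _ => hc u t), le_rfl]
  | i + 1, v => Finset.sum_nonneg fun w _ => slot_nonneg hc (throughput_nonneg hc i) v w

section Forward

variable {a Y : Fin n → ℝ}

lemma forward_nonneg (hc : ∀ v w, 0 ≤ c v w) (ha : ∀ v, 0 ≤ a v) (v w : Fin n) :
    0 ≤ forward A c a Y v w :=
  greedy_nonneg _ (slot_nonneg hc ha v) w

lemma forward_le_slot (hc : ∀ v w, 0 ≤ c v w) (ha : ∀ v, 0 ≤ a v) (v w : Fin n) :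
    forward A c a Y v w ≤ slot A c a v w :=
  greedy_le_slot _ (slot_nonneg hc ha v) w

lemma forward_eq_zero (hc : ∀ v w, 0 ≤ c v w) (ha : ∀ v, 0 ≤ a v) (v : Fin n) {w : Fin n}
    (h : a w = 0) : forward A c a Y v w = 0 :=
  le_antisymm ((forward_le_slot hc ha v w).trans ((slot_le ha v w).trans h.le))
    (forward_nonneg hc ha v w)

lemma inflow_nonneg (hc : ∀ v w, 0 ≤ c v w) (ha : ∀ v, 0 ≤ a v) (w : Fin n) :
    0 ≤ ∑ v, forward A c a Y v w :=
  Finset.sum_nonneg fun v _ => forward_nonneg hc ha v w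

lemma inflow_eq_zero (hc : ∀ v w, 0 ≤ c v w) (ha : ∀ v, 0 ≤ a v) (w : Fin n) (h : a w = 0) :
    ∑ v, forward A c a Y v w = 0 :=
  Finset.sum_eq_zero fun v _ => forward_eq_zero hc ha v h

end Forward

lemma push_nonneg_le (hc : ∀ v w, 0 ≤ c v w) : ∀ i (Y : Fin n → ℝ), (∀ v, 0 ≤ Y v) →
    (∀ v, 0 ≤ (push A t c i Y).1 v ∧ (push A t c i Y).1 v ≤ Y v) ∧
    ∀ v w, 0 ≤ (push A t c i Y).2 v w
  | 0, Y, hY => by simp [push, hY]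
  | i + 1, Y, hY => by
    have ha := throughput_nonneg (A := A) (t := t) hc i
    have ih := push_nonneg_le hc i _ (inflow_nonneg (A := A) (Y := Y) hc ha)
    have hf : ∀ v w, 0 ≤ forward A c (throughput A t c i) Y v w := forward_nonneg hc ha
    refine ⟨fun v => ⟨Finset.sum_nonneg (s := Finset.univ) fun w _ =>
      greedy_nonneg _ (fun u => hf u w) v, ?_⟩, fun v w => add_nonneg (ih.2 v w) (greedy_nonneg _ (fun u => hf u w) v)⟩
    calc _ ≤ ∑ w, forward A c (throughput A t c i) Y v w :=
          Finset.sum_le_sum fun w _ => greedy_le_slot _ (fun u => hf u w) v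
      _ ≤ Y v := by
          unfold forward
          rw [sum_greedy (hY v)]
          exact min_le_left _ _

/-- The withdrawn amounts are consistent: the recursive call sends on `D` out of the inflow, and `D`
is at most that inflow, so `backward` delivers exactly `D`. In the base case nothing may rest at a
node other than `t`, hence the condition on zeros of the throughput. -/
lemma push_conservation (hc : ∀ v w, 0 ≤ c v w) : ∀ i (Y : Fin n → ℝ), (∀ v, 0 ≤ Y v) →
    (∀ v, throughput A t c i v = 0 → Y v = 0) → ∀ v, v ≠ t →
    ∑ w, (push A t c i Y).2 v w - ∑ u, (push A t c i Y).2 u v = (push A t c i Y).1 v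
  | 0, Y, hY, h0, v, hv => by simp [push, h0 v (by simp [throughput, hv])]
  | i + 1, Y, hY, h0, v, hv => by
    have ha := throughput_nonneg (A := A) (t := t) hc i
    have ih := push_conservation hc i _ (inflow_nonneg (A := A) (Y := Y) hc ha)
      (inflow_eq_zero hc ha) v hv
    have hD := (push_nonneg_le (A := A) (t := t) hc i _
      (inflow_nonneg (A := A) (Y := Y) hc ha)).1 v
    have hb : ∑ u, backward (forward A c (throughput A t c i) Y) (push A t c i fun w =>
        ∑ v, forward A c (throughput A t c i) Y v w).1 u v = (push A t c i fun w =>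
        ∑ v, forward A c (throughput A t c i) Y v w).1 v := by
      unfold backward
      rw [sum_greedy hD.1, min_eq_left hD.2]
    simp only [push, Finset.sum_add_distrib]
    rw [hb]
    linarith

/-- Suppose that no arc is saturated further on. Then all inflows pass and stay strictly below the
throughputs. If some `v` still held at least its throughput, it would fill every slot; a positive
slot to `w` is then below the throughput of `w`, so it equals the capacity and that arc is
saturated. Otherwise every node sends its whole amount. -/
lemma push_saturates (hc : ∀ v w, 0 ≤ c v w) : ∀ i (Y : Fin n → ℝ), (∀ v, 0 ≤ Y v) →
    (∀ v, throughput A t c i v = 0 → Y v = 0) →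
    (i = 0 → ∀ v, 0 < throughput A t c 0 v → Y v < throughput A t c 0 v) →
    (∃ v w, 0 < c v w ∧ c v w ≤ (push A t c i Y).2 v w) ∨ ((push A t c i Y).1 = Y ∧
      ∀ v, 0 < throughput A t c i v → Y v < throughput A t c i v)
  | 0, Y, _, _, h0 => .inr ⟨rfl, h0 rfl⟩
  | i + 1, Y, hY, hz, _ => by
    have ha := throughput_nonneg (A := A) (t := t) hc i
    have hf : ∀ v w, 0 ≤ forward A c (throughput A t c i) Y v w := forward_nonneg hc ha
    have hnn := push_nonneg_le (A := A) (t := t) hc i _ (inflow_nonneg (A := A) (Y := Y) hc ha)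
    rcases push_saturates hc i _ (inflow_nonneg (A := A) (Y := Y) hc ha)
      (inflow_eq_zero hc ha) (by
        -- The summand 1 in the throughput of `t` makes it exceed every possible inflow, so `t`
        -- itself is never the bottleneck.
        rintro rfl v hv
        have hvt : v = t := by
          by_contra h
          simp [throughput, h] at hv
        subst hvt
        calc _ ≤ ∑ u, c u v := Finset.sum_le_sum fun u _ =>
              (forward_le_slot hc ha u v).trans (slot_le_cap hc _ u v)
          _ < _ := by simp [throughput]) with ⟨v, w, hvw, hle⟩ | ⟨hD, hlt⟩
    · exact .inl ⟨v, w, hvw, hle.trans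
        (le_add_of_nonneg_right (greedy_nonneg _ (fun u => hf u w) v))⟩
    · have hb : ∀ v w, backward (forward A c (throughput A t c i) Y) (push A t c i fun w =>
          ∑ v, forward A c (throughput A t c i) Y v w).1 v w =
          forward A c (throughput A t c i) Y v w := fun v w =>
        greedy_eq_slot (fun u => hf u w) (by rw [hD]) v
      have hs := slot_nonneg (A := A) hc ha
      by_cases hsat : ∃ v, 0 < throughput A t c (i + 1) v ∧ throughput A t c (i + 1) v ≤ Y v
      · obtain ⟨v, hv, hvY⟩ := hsat
        obtain ⟨w, -, hw⟩ := Finset.exists_lt_of_sum_lt (s := Finset.univ)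
          (f := fun _ => (0 : ℝ)) (g := slot A c (throughput A t c i) v) (by simpa [throughput] using hv)
        have hfw : forward A c (throughput A t c i) Y v w = slot A c (throughput A t c i) v w :=
          greedy_eq_slot (hs v) hvY w
        refine .inl ⟨v, w, hw.trans_le (slot_le_cap hc _ v w), ?_⟩
        have hwt := hw.trans_le (slot_le ha v w)
        have h1 : slot A c (throughput A t c i) v w < throughput A t c i w := by
          rw [← hfw]
          exact (Finset.single_le_sum (fun u _ => hf u w) (Finset.mem_univ v)).trans_lt
            (hlt w hwt)
        have h2 : slot A c (throughput A t c i) v w = c v w := by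
          unfold slot at hw h1 ⊢
          split_ifs at hw h1 ⊢ with h
          · exact min_eq_left ((min_lt_iff.1 h1).resolve_right (lt_irrefl _)).le
          · exact absurd hw (lt_irrefl _)
        have : c v w = backward (forward A c (throughput A t c i) Y) (push A t c i fun w =>
          ∑ v, forward A c (throughput A t c i) Y v w).1 v w := by rw [hb, hfw, h2]
        exact this.le.trans (le_add_of_nonneg_left (hnn.2 v w))
      · push Not at hsat
        refine .inr ⟨funext fun v => ?_, hsat⟩
        have : (push A t c (i + 1) Y).1 v = ∑ w, forward A c (throughput A t c i) Y v w :=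
          Finset.sum_congr (s₁ := Finset.univ) rfl fun w _ => hb v w
        rw [this]
        unfold forward
        rw [sum_greedy (hY v)]
        refine min_eq_left ?_
        rcases (throughput_nonneg (A := A) (t := t) hc (i + 1) v).eq_or_lt with h | h
        · rw [hz v h.symm]
          exact h.le
        · exact (hsat v h).le

lemma le_label_add_of_throughput_pos {d : Fin n → ℕ}
    (hd : ∀ v w, 0 < c v w → d w ≤ d v + 1) : ∀ i v, 0 < throughput A t c i v → d t ≤ d v + i
  | 0, v, h => by
    have hvt : v = t := by
      by_contra h'
      simp [throughput, h'] at h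
    rw [hvt]
    omega
  | i + 1, v, h => by
    obtain ⟨w, -, hw⟩ := Finset.exists_lt_of_sum_lt (s := Finset.univ)
      (f := fun _ => (0 : ℝ)) (g := slot A c (throughput A t c i) v) (by simpa [throughput] using h)
    unfold slot at hw
    split_ifs at hw with hA
    · have h1 := hd v w (hw.trans_le (min_le_left _ _))
      have h2 := le_label_add_of_throughput_pos hd i w (hw.trans_le (min_le_right _ _))
      omega
    · exact absurd hw (lt_irrefl _)

/-- With `i` steps left, flow can only be at nodes of label `k - i`: the labels cannot have grown
faster than the number of steps, and a positive throughput forces them to be large enough to reach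
`t`. Different levels of the recursion therefore use different arcs, so each arc respects its
capacity although the levels ignore each other. -/
lemma push_support (hc : ∀ v w, 0 ≤ c v w) {d : Fin n → ℕ}
    (hd : ∀ v w, 0 < c v w → d w ≤ d v + 1) {k : ℕ} (hk : k ≤ d t) :
    ∀ i (Y : Fin n → ℝ), (∀ v, 0 ≤ Y v) → (∀ v, throughput A t c i v = 0 → Y v = 0) →
    (∀ v, 0 < Y v → d v + i ≤ k) → ∀ v w, 0 < (push A t c i Y).2 v w →
    k ≤ d v + i ∧ d w = d v + 1 ∧ (v, w) ∈ A ∧ (push A t c i Y).2 v w ≤ c v w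
  | 0, Y, _, _, _, v, w, h => by simp [push] at h
  | i + 1, Y, hY, hz, hl, v, w, h => by
    have ha := throughput_nonneg (A := A) (t := t) hc i
    have hf : ∀ v w, 0 ≤ forward A c (throughput A t c i) Y v w := forward_nonneg hc ha
    have hnn := push_nonneg_le (A := A) (t := t) hc i _ (inflow_nonneg (A := A) (Y := Y) hc ha)
    have hstep : ∀ v w, 0 < forward A c (throughput A t c i) Y v w →
        (v, w) ∈ A ∧ d w ≤ d v + 1 ∧ d v + (i + 1) ≤ k ∧ k ≤ d w + i := by
      intro v w h
      have h1 := h.trans_le (forward_le_slot hc ha v w)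
      refine ⟨?_, hd v w (h1.trans_le (slot_le_cap hc _ v w)), hl v (h.trans_le
        (greedy_le_amount (hY v) (slot_nonneg hc ha v) w)), hk.trans
        (le_label_add_of_throughput_pos hd i w (h1.trans_le (slot_le ha v w)))⟩
      by_contra hA
      simp [slot, hA] at h1
    have ih := push_support hc hd hk i _ (inflow_nonneg (A := A) (Y := Y) hc ha)
      (inflow_eq_zero hc ha) (by
        intro w hw
        obtain ⟨v, -, hv⟩ := Finset.exists_lt_of_sum_lt (s := Finset.univ)
          (f := fun _ => (0 : ℝ)) (g := fun v => forward A c (throughput A t c i) Y v w)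
          (by simpa using hw)
        have := hstep v w hv
        omega) v w
    have hb0 := greedy_nonneg ((push A t c i fun w =>
      ∑ v, forward A c (throughput A t c i) Y v w).1 w) (fun u => hf u w) v
    have hb1 := greedy_le_slot ((push A t c i fun w =>
      ∑ v, forward A c (throughput A t c i) Y v w).1 w) (fun u => hf u w) v
    have hb2 := hb1.trans ((forward_le_slot hc ha v w).trans (slot_le_cap hc _ v w))
    have hg0 := hnn.2 v w
    simp only [push, backward] at h ⊢
    rcases hb0.eq_or_lt with hb | hb
    · rw [← hb, add_zero] at h ⊢
      have := ih h
      exact ⟨by omega, this.2⟩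
    · have h1 := hstep v w (hb.trans_le hb1)
      rcases hg0.eq_or_lt with hg | hg
      · rw [← hg, zero_add]
        exact ⟨by omega, by omega, h1.1, hb2⟩
      · have := ih hg
        omega

end Push

end MaxFlow

/-! ### Augmentation, distance labels and the final cut. -/

namespace MaxFlow

variable {n : ℕ}

section Augment

/-- The capacities `c` are supported on `A` and arise from the capacities `ν` as the residual
capacities of an `s`-`t`-flow. -/
structure IsResidual (A : Finset (Fin n × Fin n)) (s t : Fin n) (ν c : Fin n → Fin n → ℝ) :
    Prop where
  nonneg : ∀ v w, 0 ≤ c v w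
  eq_zero : ∀ v w, (v, w) ∉ A → c v w = 0
  add_swap : ∀ v w, c v w + c w v = ν v w + ν w v
  conservation : ∀ v, v ≠ s → v ≠ t → ∑ w, (ν v w - c v w) = 0

/-- The labels `d` are lower bounds for the distances from `s` along arcs of positive capacity,
certified locally. -/
def IsLabeling (s : Fin n) (c : Fin n → Fin n → ℝ) (d : Fin n → ℕ) : Prop :=
  d s = 0 ∧ ∀ v w, 0 < c v w → d w ≤ d v + 1

variable (A : Finset (Fin n × Fin n)) (s t : Fin n)

/-- The arcs of positive capacity along which the label increases by one. -/
noncomputable def admissible (c : Fin n → Fin n → ℝ) (d : Fin n → ℕ) : Finset (Fin n × Fin n) :=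
  open Classical in A.filter fun e => 0 < c e.1 e.2 ∧ d e.2 = d e.1 + 1

/-- A flow along walks of length `k` from `s` to `t`. -/
noncomputable def augmentingFlow (k : ℕ) (c : Fin n → Fin n → ℝ) : Fin n → Fin n → ℝ :=
  (push A t c k fun v => if v = s then throughput A t c k s else 0).2

/-- The residual capacities after adding the augmenting flow. -/
noncomputable def augment (k : ℕ) (c : Fin n → Fin n → ℝ) (v w : Fin n) : ℝ :=
  c v w - augmentingFlow A s t k c v w + augmentingFlow A s t k c w v

/-- The residual capacities after augmenting `|A|` times along walks of each length less
than `k`. -/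
noncomputable def residual (ν : Fin n → Fin n → ℝ) : ℕ → Fin n → Fin n → ℝ
  | 0 => ν
  | k + 1 => (augment A s t k)^[A.card] (residual ν k)

variable {A s t} {ν c : Fin n → Fin n → ℝ} {d : Fin n → ℕ} {k : ℕ}

lemma source_nonneg (hc : ∀ v w, 0 ≤ c v w) (v : Fin n) :
    0 ≤ if v = s then throughput A t c k s else 0 := by
  split_ifs
  exacts [throughput_nonneg hc k s, le_rfl]

lemma source_eq_zero (v : Fin n) (h : throughput A t c k v = 0) :
    (if v = s then throughput A t c k s else 0) = 0 := by
  split_ifs with hv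
  · rw [← hv, h]
  · rfl

lemma augmentingFlow_nonneg (hc : ∀ v w, 0 ≤ c v w) (v w : Fin n) :
    0 ≤ augmentingFlow A s t k c v w :=
  (push_nonneg_le hc k _ (source_nonneg hc)).2 v w

lemma augmentingFlow_support (hc : ∀ v w, 0 ≤ c v w) (hd : IsLabeling s c d) (hk : k ≤ d t)
    {v w : Fin n} (h : 0 < augmentingFlow A s t k c v w) :
    d w = d v + 1 ∧ (v, w) ∈ A ∧ augmentingFlow A s t k c v w ≤ c v w := by
  refine (push_support hc hd.2 hk k _ (source_nonneg hc) source_eq_zero ?_ v w h).2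
  intro u hu
  split_ifs at hu with hus
  · rw [hus, hd.1, zero_add]
  · exact absurd hu (lt_irrefl _)

lemma augmentingFlow_le (hc : ∀ v w, 0 ≤ c v w) (hd : IsLabeling s c d) (hk : k ≤ d t)
    (v w : Fin n) : augmentingFlow A s t k c v w ≤ c v w := by
  rcases (augmentingFlow_nonneg (A := A) (s := s) (t := t) (k := k) hc v w).eq_or_lt with h | h
  · rw [← h]
    exact hc v w
  · exact (augmentingFlow_support hc hd hk h).2.2

lemma augmentingFlow_eq_zero (hc : ∀ v w, 0 ≤ c v w) (hd : IsLabeling s c d) (hk : k ≤ d t)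
    {v w : Fin n} (h : ¬(d w = d v + 1 ∧ (v, w) ∈ A)) : augmentingFlow A s t k c v w = 0 := by
  by_contra h0
  have h1 := (augmentingFlow_nonneg (A := A) (s := s) (t := t) (k := k) hc v w).lt_of_ne' h0
  have h2 := augmentingFlow_support hc hd hk h1
  exact h ⟨h2.1, h2.2.1⟩

lemma augmentingFlow_conservation (hc : ∀ v w, 0 ≤ c v w) {v : Fin n} (hs : v ≠ s)
    (ht : v ≠ t) :
    ∑ w, augmentingFlow A s t k c v w - ∑ u, augmentingFlow A s t k c u v = 0 := by
  have h := (push_nonneg_le (A := A) (t := t) hc k _ (source_nonneg (A := A) (s := s) (t := t) (k := k)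
    hc)).1 v
  refine (push_conservation hc k _ (source_nonneg hc) source_eq_zero v ht).trans ?_
  exact le_antisymm (h.2.trans (if_neg hs).le) h.1

lemma IsResidual.augment (hA : ∀ v w, (v, w) ∈ A → (w, v) ∈ A) (hc : IsResidual A s t ν c)
    (hd : IsLabeling s c d) (hk : k ≤ d t) : IsResidual A s t ν (augment A s t k c) where
  nonneg v w := add_nonneg (sub_nonneg.2 (augmentingFlow_le hc.nonneg hd hk v w))
    (augmentingFlow_nonneg hc.nonneg w v)
  eq_zero v w h := by
    rw [MaxFlow.augment, hc.eq_zero v w h,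
      augmentingFlow_eq_zero hc.nonneg hd hk fun h' => h h'.2,
      augmentingFlow_eq_zero hc.nonneg hd hk fun h' => h (hA _ _ h'.2)]
    simp
  add_swap v w := by
    rw [← hc.add_swap v w, MaxFlow.augment, MaxFlow.augment]
    ring
  conservation v hs ht := by
    have h1 := hc.conservation v hs ht
    have h2 := augmentingFlow_conservation (A := A) (k := k) hc.nonneg hs ht
    simp only [MaxFlow.augment, Finset.sum_sub_distrib, Finset.sum_add_distrib] at h1 ⊢
    linarith

/-- An arc gains residual capacity only if flow was sent along its reverse, where the label rises;
so the label drops along the arc itself. -/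
lemma IsLabeling.augment (hc : ∀ v w, 0 ≤ c v w) (hd : IsLabeling s c d) (hk : k ≤ d t) :
    IsLabeling s (augment A s t k c) d := by
  refine ⟨hd.1, fun v w h => ?_⟩
  rcases (augmentingFlow_nonneg (A := A) (s := s) (t := t) (k := k) hc w v).eq_or_lt with h0 | h0
  · rw [MaxFlow.augment, ← h0, add_zero] at h
    have := augmentingFlow_nonneg (A := A) (s := s) (t := t) (k := k) hc v w
    exact hd.2 v w (by linarith)
  · have := (augmentingFlow_support hc hd hk h0).1
    omega

lemma admissible_augment_subset (hc : ∀ v w, 0 ≤ c v w) (hd : IsLabeling s c d) (hk : k ≤ d t) :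
    admissible A (augment A s t k c) d ⊆ admissible A c d := by
  rintro ⟨v, w⟩ h
  simp only [admissible, Finset.mem_filter] at h ⊢
  refine ⟨h.1, ?_, h.2.2⟩
  have h1 := h.2.1
  rw [augment, augmentingFlow_eq_zero (v := w) (w := v) hc hd hk fun h' => by omega] at h1
  have := augmentingFlow_nonneg (A := A) (s := s) (t := t) (k := k) hc v w
  linarith

lemma admissible_augment_ssubset (hc : ∀ v w, 0 ≤ c v w) (hd : IsLabeling s c d) (hk : k ≤ d t)
    (hst : s ≠ t) (hpos : 0 < throughput A t c k s) :
    admissible A (augment A s t k c) d ⊂ admissible A c d := by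
  refine (Finset.ssubset_iff_of_subset (admissible_augment_subset hc hd hk)).2 ?_
  rcases push_saturates (A := A) (t := t) hc k _ (source_nonneg (s := s) hc) source_eq_zero
    (by
      rintro rfl v hv
      rwa [if_neg]
      rintro rfl
      simp [throughput, hst] at hv) with ⟨v, w, hvw, hle⟩ | ⟨-, h⟩
  · change c v w ≤ augmentingFlow A s t k c v w at hle
    have h := augmentingFlow_support hc hd hk (hvw.trans_le hle)
    refine ⟨(v, w), by simp [admissible, hvw, h.1, h.2.1], fun h' => ?_⟩
    simp only [admissible, Finset.mem_filter] at h'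
    have h1 := h'.2.1
    rw [augment, augmentingFlow_eq_zero (v := w) (w := v) hc hd hk fun h' => by omega] at h1
    linarith
  · have := h s hpos
    rw [if_pos rfl] at this
    exact absurd this (lt_irrefl _)

/-- If `d t = k`, the labels of exactly those nodes `v` are raised by one from which `t` can be
reached in `d t - d v` steps. This includes `t` but not `s`. If a raised node `w` has label `d v +
1` and the arc from `v` has positive capacity, then `v` is raised too, so the labeling stays valid.
-/
lemma IsLabeling.exists_succ_le (hc : IsResidual A s t ν c) (hd : IsLabeling s c d)
    (hk : k ≤ d t) (h0 : throughput A t c k s ≤ 0) : ∃ d', IsLabeling s c d' ∧ k + 1 ≤ d' t := by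
  classical
  rcases hk.eq_or_lt with rfl | hk
  swap
  · exact ⟨d, hd, hk⟩
  have hnn := fun i v => throughput_nonneg (A := A) (t := t) hc.nonneg i v
  refine ⟨fun v => if d v ≤ d t ∧ 0 < throughput A t c (d t - d v) v then d v + 1 else d v,
    ⟨?_, fun v w hvw => ?_⟩, ?_⟩
  · simp only [hd.1, tsub_zero, h0.not_gt, and_false, if_false]
  · have h1 := hd.2 v w hvw
    by_cases hle : d w ≤ d v
    · simp only
      split_ifs <;> omega
    by_cases hw : d w ≤ d t ∧ 0 < throughput A t c (d t - d w) w
    · have hA : (v, w) ∈ A := by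
        by_contra h
        exact hvw.ne' (hc.eq_zero v w h)
      have hv : d v ≤ d t ∧ 0 < throughput A t c (d t - d v) v := by
        refine ⟨by omega, ?_⟩
        rw [show d t - d v = d t - d w + 1 by omega, throughput]
        refine (lt_min hvw hw.2).trans_le ?_
        have := Finset.single_le_sum (s := Finset.univ)
          (fun u _ => slot_nonneg (A := A) hc.nonneg (hnn (d t - d w)) v u) (Finset.mem_univ w)
        rwa [slot, if_pos hA] at this
      simp only [if_pos hv, if_pos hw]
      omega
    · simp only [if_neg hw]
      split_ifs <;> omega
  · have : 0 < throughput A t c 0 t := by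
      have := Finset.sum_nonneg fun u (_ : u ∈ Finset.univ) => hc.nonneg u t
      simp only [throughput, if_true]
      linarith
    simp [this]

/-- Each round either removes an admissible arc or finds zero throughput, in which case the labels
can be raised for good. -/
lemma iterate_augment (hA : ∀ v w, (v, w) ∈ A → (w, v) ∈ A) (hst : s ≠ t)
    (hc : IsResidual A s t ν c) (hd : IsLabeling s c d) (hk : k ≤ d t) (j : ℕ) :
    IsResidual A s t ν ((augment A s t k)^[j] c) ∧
      ∃ d', IsLabeling s ((augment A s t k)^[j] c) d' ∧ k ≤ d' t ∧
      (k + 1 ≤ d' t ∨ (admissible A ((augment A s t k)^[j] c) d').card + j ≤ A.card) := by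
  induction j with
  | zero =>
    exact ⟨hc, d, hd, hk, .inr (Finset.card_le_card (Finset.filter_subset _ _))⟩
  | succ j ih =>
    obtain ⟨hr, d', hd', hk', h⟩ := ih
    rw [Function.iterate_succ_apply']
    refine ⟨hr.augment hA hd' hk', ?_⟩
    rcases h with h | h
    · exact ⟨d', hd'.augment hr.nonneg hk', hk', .inl h⟩
    rcases lt_or_ge 0 (throughput A t ((augment A s t k)^[j] c) k s) with hp | hp
    · have := Finset.card_lt_card (admissible_augment_ssubset hr.nonneg hd' hk' hst hp)
      exact ⟨d', hd'.augment hr.nonneg hk', hk', .inr (by omega)⟩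
    · obtain ⟨d'', hd'', hk''⟩ := hd'.exists_succ_le hr hk' hp
      have := (Nat.le_succ k).trans hk''
      exact ⟨d'', hd''.augment hr.nonneg this, this, .inl hk''⟩

lemma isResidual_residual (hA : ∀ v w, (v, w) ∈ A → (w, v) ∈ A) (hst : s ≠ t)
    (hν : ∀ v w, 0 ≤ ν v w) (hνA : ∀ v w, (v, w) ∉ A → ν v w = 0) (k : ℕ) :
    IsResidual A s t ν (residual A s t ν k) ∧
      ∃ d, IsLabeling s (residual A s t ν k) d ∧ k ≤ d t := by
  induction k with
  | zero => exact ⟨⟨hν, hνA, fun _ _ => rfl, by simp [residual]⟩, 0, by simp [IsLabeling], by simp⟩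
  | succ k ih =>
    obtain ⟨hr, d, hd, hk⟩ := ih
    obtain ⟨hr', d', hd', hk', h⟩ := iterate_augment hA hst hr hd hk A.card
    refine ⟨hr', ?_⟩
    rcases h with h | h
    · exact ⟨d', hd', h⟩
    -- After `A.card` rounds no admissible arc is left to lose, so the throughput must be zero.
    · refine hd'.exists_succ_le hr' hk' (not_lt.1 fun hp => ?_)
      have := Finset.card_lt_card (admissible_augment_ssubset hr'.nonneg hd' hk' hst hp)
      omega

/-- The `n - 1` nodes other than `s` miss some label `j` in 1, ..., n. An arc of positive capacity
leaving the set of labels below `j` would have to end at label exactly `j`. -/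
lemma IsLabeling.exists_cut (hd : IsLabeling s c d) (hn : n ≤ d t) (hc : ∀ v w, 0 ≤ c v w) :
    ∃ S : Finset (Fin n), s ∈ S ∧ t ∉ S ∧ ∀ v ∈ S, ∀ w ∉ S, c v w = 0 := by
  have hcard : ((Finset.univ.erase s).image d).card < (Finset.Icc 1 n).card := by
    refine Finset.card_image_le.trans_lt ?_
    have := s.pos
    simp only [Finset.card_erase_of_mem (Finset.mem_univ s), Finset.card_univ, Fintype.card_fin,
      Nat.card_Icc]
    omega
  obtain ⟨j, hj, hj'⟩ := Finset.exists_mem_notMem_of_card_lt_card hcard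
  rw [Finset.mem_Icc] at hj
  refine ⟨Finset.univ.filter fun v => d v < j, ?_, ?_, fun v hv w hw => ?_⟩
  · simp only [Finset.mem_filter, Finset.mem_univ, true_and, hd.1]
    omega
  · simp only [Finset.mem_filter, Finset.mem_univ, true_and]
    omega
  · simp only [Finset.mem_filter, Finset.mem_univ, true_and] at hv hw
    by_contra h
    have h1 := hd.2 v w ((hc v w).lt_of_ne' h)
    refine hj' (Finset.mem_image.2 ⟨w, Finset.mem_erase.2 ⟨?_, Finset.mem_univ w⟩, by omega⟩)
    rintro rfl
    exact hw (by rw [hd.1]; omega)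

end Augment

/-! ### Cuts, flows and optimality. -/

section Flow

/-- Antisymmetry cancels the contributions inside `S`. -/
lemma sum_outside_eq {z : Fin n → Fin n → ℝ} (hz : ∀ v w, z v w = -z w v) (S : Finset (Fin n)) :
    ∑ v ∈ S, ∑ w, z v w = ∑ v ∈ S, ∑ w ∈ Sᶜ, z v w := by
  have h0 : ∑ v ∈ S, ∑ w ∈ S, z v w = 0 := by
    have h : ∑ v ∈ S, ∑ w ∈ S, z v w = -∑ v ∈ S, ∑ w ∈ S, z v w := by
      conv_lhs => rw [Finset.sum_comm]
      simp only [← Finset.sum_neg_distrib]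
      exact Finset.sum_congr rfl fun v _ => Finset.sum_congr rfl fun w _ => hz w v
    linarith
  simp only [← fun v => Finset.sum_add_sum_compl S (z v), Finset.sum_add_distrib, h0, zero_add]

lemma netOutflow_eq_cut {z : Fin n → Fin n → ℝ} (hz : ∀ v w, z v w = -z w v) {s t : Fin n}
    (hcons : ∀ v, v ≠ s → v ≠ t → ∑ w, z v w = 0) {S : Finset (Fin n)} (hs : s ∈ S)
    (ht : t ∉ S) : ∑ w, z s w = ∑ v ∈ S, ∑ w ∈ Sᶜ, z v w := by
  rw [← sum_outside_eq hz, Finset.sum_eq_single s (fun v hv hvs => hcons v hvs ?_)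
    fun h => absurd hs h]
  rintro rfl
  exact ht hv

variable {E : Finset (Fin n × Fin n)} {s t : Fin n} {ν y : E → ℝ}

lemma flowOn_coe (y : E → ℝ) (e : E) : flowOn E y e.1 = y e := dif_pos e.2

lemma sum_filter_eq_sum_flowOn (y : E → ℝ) (p : Fin n × Fin n → Prop) [DecidablePred p] :
    ∑ e : E with p e.1, y e = ∑ e, if p e then flowOn E y e else 0 := by
  rw [Finset.sum_filter, ← Finset.sum_subset (Finset.subset_univ E) fun e _ he => by
    simp [flowOn, he], ← Finset.sum_coe_sort E]
  exact Finset.sum_congr rfl fun e _ => by rw [flowOn_coe]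

lemma outflow_eq (y : E → ℝ) (v : Fin n) :
    ∑ e : E with e.1.1 = v, y e = ∑ w, flowOn E y (v, w) := by
  rw [sum_filter_eq_sum_flowOn y fun e => e.1 = v, Fintype.sum_prod_type]
  simp only
  rw [Finset.sum_eq_single v (fun u _ hu => by simp [hu]) (by simp)]
  simp

lemma inflow_eq (y : E → ℝ) (v : Fin n) :
    ∑ e : E with e.1.2 = v, y e = ∑ u, flowOn E y (u, v) := by
  rw [sum_filter_eq_sum_flowOn y fun e => e.2 = v, Fintype.sum_prod_type]
  simp

lemma value_eq (y : E → ℝ) :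
    value E s y = ∑ w, (flowOn E y (s, w) - flowOn E y (w, s)) := by
  rw [value, outflow_eq, inflow_eq, Finset.sum_sub_distrib]

lemma isFlow_iff : IsFlow E s t ν y ↔ (∀ e, 0 ≤ y e ∧ y e ≤ ν e) ∧
    ∀ v, v ≠ s → v ≠ t → ∑ w, (flowOn E y (v, w) - flowOn E y (w, v)) = 0 := by
  simp only [IsFlow, outflow_eq, inflow_eq, Finset.sum_sub_distrib, sub_eq_zero]
  exact and_congr_right fun _ => forall_congr' fun v => imp_congr_right fun _ =>
    imp_congr_right fun _ => eq_comm

lemma flowOn_nonneg (hy : ∀ e, 0 ≤ y e) (e : Fin n × Fin n) : 0 ≤ flowOn E y e := by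
  unfold flowOn
  split_ifs
  exacts [hy _, le_rfl]

lemma flowOn_mono {y y' : E → ℝ} (hy : ∀ e, y e ≤ y' e) (e : Fin n × Fin n) :
    flowOn E y e ≤ flowOn E y' e := by
  unfold flowOn
  split_ifs
  exacts [hy _, le_rfl]

lemma value_le_cut {y : E → ℝ} (hy : IsFlow E s t ν y) {S : Finset (Fin n)} (hs : s ∈ S)
    (ht : t ∉ S) : value E s y ≤ ∑ v ∈ S, ∑ w ∈ Sᶜ, flowOn E ν (v, w) := by
  rw [isFlow_iff] at hy
  rw [value_eq, netOutflow_eq_cut (z := fun v w => flowOn E y (v, w) - flowOn E y (w, v))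
    (fun v w => (neg_sub _ _).symm) hy.2 hs ht]
  refine Finset.sum_le_sum fun v _ => Finset.sum_le_sum fun w _ => ?_
  have h1 := flowOn_mono (fun e => (hy.1 e).2) (v, w)
  have h2 := flowOn_nonneg (fun e => (hy.1 e).1) (w, v)
  linarith

/-- The arcs of a graph and their reverses. -/
def symmetricArcs (E : Finset (Fin n × Fin n)) : Finset (Fin n × Fin n) :=
  E ∪ E.image Prod.swap

lemma mem_symmetricArcs_swap (v w : Fin n) (h : (v, w) ∈ symmetricArcs E) :
    (w, v) ∈ symmetricArcs E := by
  simp only [symmetricArcs, Finset.mem_union, Finset.mem_image, Prod.exists, Prod.swap_prod_mk,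
    Prod.mk.injEq] at h ⊢
  rcases h with h | ⟨a, b, h, rfl, rfl⟩
  exacts [.inr ⟨v, w, h, rfl, rfl⟩, .inl h]

lemma card_symmetricArcs_le : (symmetricArcs E).card ≤ 2 * E.card := by
  have h1 := Finset.card_union_le E (E.image Prod.swap)
  have h2 := Finset.card_image_le (s := E) (f := Prod.swap)
  rw [symmetricArcs]
  omega

theorem exists_isMaxFlow (hst : s ≠ t) (hν : ∀ e, 0 ≤ ν e) :
    ∃ y, IsMaxFlow E s t ν y ∧ ∀ v w, flowOn E y (v, w) - flowOn E y (w, v) =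
      flowOn E ν (v, w) -
        residual (symmetricArcs E) s t (fun v w => flowOn E ν (v, w)) n v w := by
  obtain ⟨hr, d, hd, hn⟩ := isResidual_residual (A := symmetricArcs E) (s := s) (t := t)
    (ν := fun v w => flowOn E ν (v, w)) mem_symmetricArcs_swap hst
    (fun v w => flowOn_nonneg hν _)
    (fun v w h => dif_neg fun h' => h (Finset.mem_union_left _ h')) n
  obtain ⟨S, hs, ht, hS⟩ := hd.exists_cut hn hr.nonneg
  set c := residual (symmetricArcs E) s t (fun v w => flowOn E ν (v, w)) n
  -- The difference of capacity and residual capacity is antisymmetric by `add_swap`, so its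
  -- positive part never uses an arc and its reverse at once, and the signed flow recovers the
  -- difference.
  let y : E → ℝ := fun e => max 0 (ν e - c e.1.1 e.1.2)
  have hy : ∀ v w, flowOn E y (v, w) = max 0 (flowOn E ν (v, w) - c v w) := by
    intro v w
    unfold flowOn
    split_ifs
    · rfl
    · rw [max_eq_left]
      linarith [hr.nonneg v w]
  have hx : ∀ v w, flowOn E y (v, w) - flowOn E y (w, v) = flowOn E ν (v, w) - c v w := by
    intro v w
    have := hr.add_swap v w
    rw [hy, hy, show flowOn E ν (w, v) - c w v = -(flowOn E ν (v, w) - c v w) by linarith]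
    rcases le_total 0 (flowOn E ν (v, w) - c v w) with h | h
    · rw [max_eq_right h, max_eq_left (by linarith), sub_zero]
    · rw [max_eq_left h, max_eq_right (by linarith), zero_sub, neg_neg]
  have hflow : IsFlow E s t ν y := by
    refine isFlow_iff.2 ⟨fun e => ⟨le_max_left _ _, max_le (hν e) ?_⟩, fun v hs ht => ?_⟩
    · linarith [hr.nonneg e.1.1 e.1.2]
    · simp only [hx]
      exact hr.conservation v hs ht
  refine ⟨y, ⟨hflow, fun y' hy' => (value_le_cut hy' hs ht).trans_eq ?_⟩, hx⟩
  rw [value_eq, netOutflow_eq_cut (z := fun v w => flowOn E y (v, w) - flowOn E y (w, v))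
    (fun v w => (neg_sub _ _).symm) (isFlow_iff.1 hflow).2 hs ht]
  refine Finset.sum_congr rfl fun v hv => Finset.sum_congr rfl fun w hw => ?_
  rw [hx, hS v hv w (Finset.mem_compl.1 hw), sub_zero]

end Flow

end MaxFlow

/-! ### Counting the positive parts used by the algorithm. -/

namespace MaxFlow

section Steps

variable {n : ℕ} {X : Type} {A : Finset (Fin n × Fin n)} {s t : Fin n}
  {c : X → Fin n → Fin n → ℝ} {W : Submodule ℝ (X → ℝ)}

lemma fun_sum_mem {α : Type} (S : Finset α) {f : α → X → ℝ} (hf : ∀ i ∈ S, f i ∈ W) :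
    (fun x => ∑ i ∈ S, f i x) ∈ W := by
  have : (fun x => ∑ i ∈ S, f i x) = ∑ i ∈ S, f i := by
    ext x
    simp
  rw [this]
  exact sum_mem hf

lemma fun_prefixSum_mem {z : X → Fin n → ℝ} (hz : ∀ v, (fun x => z x v) ∈ W) (j : ℕ) :
    (fun x => prefixSum (z x) j) ∈ W :=
  fun_sum_mem _ fun v _ => hz v

lemma reluSteps_slot (hc : ∀ v w, (fun x => c x v w) ∈ W) {a : X → Fin n → ℝ}
    (ha : ∀ v, (fun x => a x v) ∈ W) : ∃ W', ReluSteps A.card W W' ∧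
      ∀ v w, (fun x => slot A (c x) (a x) v w) ∈ W' := by
  obtain ⟨W', h, hmin⟩ := ReluSteps.exists_mins A W
    (f := fun e x => c x e.1 e.2) (g := fun e x => a x e.2) (fun e _ => hc e.1 e.2)
    fun e _ => ha e.2
  refine ⟨W', h, fun v w => ?_⟩
  by_cases hA : (v, w) ∈ A
  · simpa only [slot, hA, if_true] using hmin (v, w) hA
  · simp only [slot, hA, if_false]
    exact W'.zero_mem

lemma reluSteps_throughput (h1 : (fun _ => 1) ∈ W) (hc : ∀ v w, (fun x => c x v w) ∈ W) (i : ℕ) :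
    ∃ W', ReluSteps (A.card * i) W W' ∧
      ∀ j ≤ i, ∀ v, (fun x => throughput A t (c x) j v) ∈ W' := by
  induction i with
  | zero =>
    refine ⟨W, .refl W, fun j hj v => ?_⟩
    obtain rfl := Nat.le_zero.1 hj
    unfold throughput
    split_ifs
    exacts [add_mem h1 (fun_sum_mem _ fun u _ => hc u t), W.zero_mem]
  | succ i ih =>
    obtain ⟨W', h, ha⟩ := ih
    obtain ⟨W'', h', hs⟩ := reluSteps_slot (A := A) (fun v w => h.le (hc v w)) (ha i le_rfl)
    refine ⟨W'', h.trans h', fun j hj v => ?_⟩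
    rcases hj.eq_or_lt with rfl | hj
    · exact fun_sum_mem _ fun w _ => hs v w
    · exact h'.le (ha j (by omega) v)

/-- Greedy distributions whose slots are zero except for those labelled by the elements of `A`. -/
lemma reluSteps_greedy {Y : Fin n × Fin n → X → ℝ} {z : Fin n × Fin n → X → Fin n → ℝ}
    {i : Fin n × Fin n → Fin n} (hY : ∀ e, Y e ∈ W) (hz : ∀ e v, (fun x => z e x v) ∈ W)
    (h0 : ∀ e ∉ A, ∀ x, z e x (i e) = 0) : ∃ W', ReluSteps (2 * A.card) W W' ∧
      ∀ e, (fun x => greedy (Y e x) (z e x) (i e)) ∈ W' := by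
  obtain ⟨W', h, hmin⟩ := ReluSteps.exists_mins A W (f := Y)
    (g := fun e x => prefixSum (z e x) ((i e).1 + 1)) (fun e _ => hY e)
    fun e _ => fun_prefixSum_mem (hz e) _
  obtain ⟨W'', h', hmin'⟩ := ReluSteps.exists_mins A W' (f := Y)
    (g := fun e x => prefixSum (z e x) (i e).1) (fun e _ => h.le (hY e))
    fun e _ => h.le (fun_prefixSum_mem (hz e) _)
  refine ⟨W'', two_mul A.card ▸ h.trans h', fun e => ?_⟩
  by_cases he : e ∈ A
  · exact sub_mem (h'.le (hmin e he)) (hmin' e he)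
  · simp only [greedy_of_eq_zero _ (h0 e he _)]
    exact W''.zero_mem

lemma reluSteps_push (hc : ∀ v w, (fun x => c x v w) ∈ W) (i : ℕ) {Y : X → Fin n → ℝ}
    (hY : ∀ v, (fun x => Y x v) ∈ W)
    (ha : ∀ j ≤ i, ∀ v, (fun x => throughput A t (c x) j v) ∈ W) :
    ∃ W', ReluSteps (5 * A.card * i) W W' ∧
      (∀ v, (fun x => (push A t (c x) i (Y x)).1 v) ∈ W') ∧
      ∀ v w, (fun x => (push A t (c x) i (Y x)).2 v w) ∈ W' := by
  induction i generalizing W Y with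
  | zero => exact ⟨W, .refl W, hY, fun _ _ => W.zero_mem⟩
  | succ i ih =>
    obtain ⟨W₁, h₁, hs⟩ := reluSteps_slot (A := A) hc (ha i (by omega))
    obtain ⟨W₂, h₂, hf⟩ := reluSteps_greedy (A := A) (W := W₁) (Y := fun e x => Y x e.1)
      (z := fun e x => slot A (c x) (throughput A t (c x) i) e.1) (i := Prod.snd)
      (fun e => h₁.le (hY e.1)) (fun e => hs e.1) (fun e he x => if_neg he)
    have h₁₂ := h₁.trans h₂
    obtain ⟨W₃, h₃, hD, hg⟩ := ih (W := W₂)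
      (Y := fun x w => ∑ v, forward A (c x) (throughput A t (c x) i) (Y x) v w)
      (fun v w => h₁₂.le (hc v w)) (fun w => fun_sum_mem _ fun v _ => hf (v, w))
      fun j hj v => h₁₂.le (ha j (by omega) v)
    obtain ⟨W₄, h₄, hb⟩ := reluSteps_greedy (A := A) (W := W₃)
      (Y := fun e x => (push A t (c x) i fun w =>
        ∑ v, forward A (c x) (throughput A t (c x) i) (Y x) v w).1 e.2)
      (z := fun e x u => forward A (c x) (throughput A t (c x) i) (Y x) u e.2) (i := Prod.fst)
      (fun e => hD e.2) (fun e u => h₃.le (hf (u, e.2)))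
      (fun e he x => greedy_of_eq_zero _ (if_neg he))
    refine ⟨W₄, ?_, fun v => fun_sum_mem Finset.univ fun w _ => hb (v, w),
      fun v w => add_mem (h₄.le (hg v w)) (hb (v, w))⟩
    -- Per level and arc there is one minimum for the slot and two for each of the two greedy
    -- distributions.
    convert (h₁₂.trans h₃).trans h₄ using 1
    ring

lemma reluSteps_augment (h1 : (fun _ => 1) ∈ W) (hc : ∀ v w, (fun x => c x v w) ∈ W) (k : ℕ) :
    ∃ W', ReluSteps (6 * A.card * k) W W' ∧
      ∀ v w, (fun x => augment A s t k (c x) v w) ∈ W' := by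
  obtain ⟨W₁, h₁, ha⟩ := reluSteps_throughput (A := A) (t := t) h1 hc k
  obtain ⟨W₂, h₂, -, hg⟩ := reluSteps_push (A := A) (t := t)
    (Y := fun x v => if v = s then throughput A t (c x) k s else 0)
    (fun v w => h₁.le (hc v w)) k (fun v => by
      split_ifs
      exacts [ha k le_rfl s, W₁.zero_mem]) ha
  refine ⟨W₂, ?_, fun v w => add_mem (sub_mem (h₂.le (h₁.le (hc v w))) (hg v w)) (hg w v)⟩
  convert h₁.trans h₂ using 1
  ring

lemma reluSteps_iterate_augment (h1 : (fun _ => 1) ∈ W) (hc : ∀ v w, (fun x => c x v w) ∈ W)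
    (k j : ℕ) : ∃ W', ReluSteps (6 * A.card * k * j) W W' ∧
      ∀ v w, (fun x => (augment A s t k)^[j] (c x) v w) ∈ W' := by
  induction j with
  | zero => exact ⟨W, .refl W, hc⟩
  | succ j ih =>
    obtain ⟨W₁, h₁, hc₁⟩ := ih
    obtain ⟨W₂, h₂, hc₂⟩ := reluSteps_augment (A := A) (s := s) (t := t) (h₁.le h1) hc₁ k
    refine ⟨W₂, h₁.trans h₂, fun v w => ?_⟩
    simp only [Function.iterate_succ_apply']
    exact hc₂ v w

lemma reluSteps_residual (h1 : (fun _ => 1) ∈ W) (hc : ∀ v w, (fun x => c x v w) ∈ W) (k : ℕ) :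
    ∃ K W', K ≤ 6 * A.card ^ 2 * k ^ 2 ∧ ReluSteps K W W' ∧
      ∀ v w, (fun x => residual A s t (c x) k v w) ∈ W' := by
  induction k with
  | zero => exact ⟨0, W, by simp, .refl W, hc⟩
  | succ k ih =>
    obtain ⟨K, W₁, hK, h₁, hc₁⟩ := ih
    obtain ⟨W₂, h₂, hc₂⟩ := reluSteps_iterate_augment (A := A) (s := s) (t := t) (h₁.le h1) hc₁ k
      A.card
    refine ⟨_, W₂, ?_, h₁.trans h₂, hc₂⟩
    -- Phase `k` consists of `A.card` augmentations that cost `6 * A.card * k` each.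
    calc K + 6 * A.card * k * A.card ≤ 6 * A.card ^ 2 * k ^ 2 + 6 * A.card * k * A.card :=
          Nat.add_le_add_right hK _
      _ = 6 * A.card ^ 2 * (k ^ 2 + k) := by ring
      _ ≤ 6 * A.card ^ 2 * (k + 1) ^ 2 := Nat.mul_le_mul_left _ (by nlinarith)

end Steps

variable {n : ℕ} {E : Finset (Fin n × Fin n)}

lemma nonempty_forwardArcs (hE : ∀ v, (v, v) ∉ E) (h : E.Nonempty) :
    (forwardArcs E).Nonempty := by
  obtain ⟨⟨v, w⟩, h⟩ := h
  rcases lt_trichotomy v w with hvw | rfl | hvw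
  · exact ⟨(v, w), by simp [forwardArcs, hvw, h]⟩
  · exact absurd h (hE v)
  · exact ⟨(w, v), by simp [forwardArcs, hvw, h]⟩

/-- The net outflows of all nodes add up to zero and vanish away from `s`, so every flow has value 0
when source and sink coincide. -/
lemma isMaxFlow_zero {s : Fin n} {ν : E → ℝ} (hν : ∀ e, 0 ≤ ν e) : IsMaxFlow E s s ν 0 := by
  refine ⟨⟨fun e => ⟨le_rfl, hν e⟩, by simp⟩, fun y hy => ?_⟩
  have h := sum_outside_eq (z := fun v w => flowOn E y (v, w) - flowOn E y (w, v))
    (fun v w => (neg_sub _ _).symm) Finset.univ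
  rw [Finset.compl_univ, Finset.sum_eq_single s
    (fun v _ hv => (isFlow_iff.1 hy).2 v hv hv) (by simp)] at h
  rw [value_eq, h]
  simp [value]

end MaxFlow

theorem mainTheorem1 :
    ∃ C : ℕ, ∀ (n m : ℕ) (E : Finset (Fin n × Fin n)) (s t : Fin n),
      (∀ v : Fin n, (v, v) ∉ E) → E.card = m → 1 ≤ m →
      ∃ N : ReLUNN E (MaxFlow.forwardArcs E),
        N.depth ≤ C * (m ^ 2 * n ^ 2) ∧ N.size ≤ C * (m ^ 2 * n ^ 2) ∧ N.width ≤ C ∧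
        ∀ ν : E → ℝ, (∀ e, 0 ≤ ν e) →
          ∃ y : E → ℝ, MaxFlow.IsMaxFlow E s t ν y ∧
            N.forwardPass ν = MaxFlow.signed E y := by
  -- Symmetrizing at most doubles the arcs, so at most 6(2m)²n² = 24m²n² hidden neurons are needed;
  -- the output layer adds one to the depth.
  refine ⟨25, fun n m E s t hE hm h1 => ?_⟩
  have hne : E.Nonempty := Finset.card_pos.1 (by omega)
  have : Nonempty E := hne.to_subtype
  have : Nonempty (MaxFlow.forwardArcs E) := (MaxFlow.nonempty_forwardArcs hE hne).to_subtype
  have hpos : 1 ≤ m ^ 2 * n ^ 2 := Nat.mul_pos (pow_pos h1 2) (pow_pos s.pos 2)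
  have hconst := one_mem_affineFunctions E
  rcases eq_or_ne s t with rfl | hst
  · obtain ⟨N, hdepth, hsize, hwidth, hN⟩ := ReLUNN.exists_of_reluSteps
      (κ := MaxFlow.forwardArcs E) (.refl (affineFunctions E)) (F := 0) fun o => zero_mem _
    refine ⟨N, by omega, by omega, by omega, fun ν hν => ⟨0, MaxFlow.isMaxFlow_zero hν, ?_⟩⟩
    ext o
    rw [hN]
    simp [MaxFlow.signed, MaxFlow.flowOn]
  · have hcap : ∀ v w, (fun ν => MaxFlow.flowOn E ν (v, w)) ∈ affineFunctions E := by
      intro v w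
      unfold MaxFlow.flowOn
      split_ifs
      exacts [coord_mem_affineFunctions _, zero_mem _]
    obtain ⟨K, W, hK, hsteps, hres⟩ := MaxFlow.reluSteps_residual
      (A := MaxFlow.symmetricArcs E) (s := s) (t := t)
      (c := fun ν v w => MaxFlow.flowOn E ν (v, w)) hconst hcap n
    obtain ⟨N, hdepth, hsize, hwidth, hN⟩ := ReLUNN.exists_of_reluSteps
      (κ := MaxFlow.forwardArcs E) hsteps
      (F := fun o ν => MaxFlow.flowOn E ν (o.1.1, o.1.2) - MaxFlow.residual
        (MaxFlow.symmetricArcs E) s t (fun v w => MaxFlow.flowOn E ν (v, w)) n o.1.1 o.1.2)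
      fun o => sub_mem (hsteps.le (hcap _ _)) (hres _ _)
    have hK' : K ≤ 24 * (m ^ 2 * n ^ 2) := by
      refine hK.trans ?_
      calc 6 * (MaxFlow.symmetricArcs E).card ^ 2 * n ^ 2 ≤ 6 * (2 * E.card) ^ 2 * n ^ 2 := by
            gcongr
            exact MaxFlow.card_symmetricArcs_le
        _ = 24 * (m ^ 2 * n ^ 2) := by rw [hm]; ring
    refine ⟨N, by omega, by omega, by omega, fun ν hν => ?_⟩
    obtain ⟨y, hy, hx⟩ := MaxFlow.exists_isMaxFlow hst hν
    refine ⟨y, hy, ?_⟩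
    ext o
    rw [hN, ← hx]
    rfl
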